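/- Theorem (multilabeled Sperner's lemma). Let $n\ge 1$ and $m$ be natural numbers, let $p_1,\ldots,p_n$ be affinely independent points of a Euclidean space, and let $\Delta^{n-1}=\operatorname{conv}(\{p_1,\ldots,p_n\})$. Let $T$ be a triangulation of $\Delta^{n-1}$, that is, a finite collection of simplices with union $\Delta^{n-1}$ that contains every face of each of its simplices and in which any two simplices are disjoint or meet in a common face. Let $\lambda_1,\ldots,\lambda_m$ be Sperner labelings of $T$: each $\lambda_i$ assigns to every vertex of $T$ a label in $\{1,\ldots,n\}$ such that, for every $S\subseteq\{1,\ldots,n\}$, each vertex of $T$ lying in the face $\operatorname{conv}\{p_j : j\in S\}$ receives a label from $S$. Then: (1) for any positive integers $k_1,\ldots,k_m$ with $k_1+\cdots+k_m=m+n-1$ there is a simplex $\sigma\in T$ such that, for each $i\in\{1,\ldots,m\}$, the labeling $\lambda_i$ uses at least $k_i$ distinct labels on the vertices of $\sigma$; (2) for any positive integers $l_1,\ldots,l_n$ with $l_1+\cdots+l_n=m+n-1$ there is a simplex $\tau\in T$ such that, for each $j\in\{1,\ldots,n\}$, at least $l_j$ of the labelings $\lambda_1,\ldots,\lambda_m$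 use the label $j$ on some vertex of $\tau$. -/

import Mathlib

namespace MultiSperner

variable {E : Type*} [NormedAddCommGroup E] [InnerProductSpace ℝ E]

/-- `K` is a (finite) triangulation of the set `P`: a finite simplicial complex (finitely many
simplices, closed under taking faces, any two meeting in a common face or not at all) whose
simplices have union `P`. -/
structure IsTriangulation (K : Geometry.SimplicialComplex ℝ E) (P : Set E) : Prop where
  finite_faces : K.faces.Finite
  space_eq : K.space = P

/-- A labeling of the vertices of `K` by `n` labels is a Sperner labeling, with respect to the
simplex with vertices `p 0, …, p (n - 1)`, if each vertex of `K` that lies in the face spanned by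
`p j`, `j ∈ S`, receives a label from `S`. -/
def IsSpernerLabeling {n : ℕ} (p : Fin n → E) (K : Geometry.SimplicialComplex ℝ E)
    (lab : K.vertices → Fin n) : Prop :=
  ∀ (v : K.vertices) (S : Set (Fin n)), (v : E) ∈ convexHull ℝ (p '' S) → lab v ∈ S

/-- The set of labels that the labeling `lab` uses on the simplex with vertex set `s`. -/
def labelsOn {n : ℕ} {K : Geometry.SimplicialComplex ℝ E} (lab : K.vertices → Fin n)
    (s : Finset E) : Set (Fin n) :=
  {j | ∃ v : K.vertices, (v : E) ∈ s ∧ lab v = j}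

end MultiSperner

/-! Each labeling extends linearly over the simplices of `T` to a map into the standard simplex, and
the theorem comes from a weighted average of these maps. Give labeling `i` weight `r i`, with total
`∑ j, y j`; then the average `G` attains `y` at some point (`exists_face_average`). In the simplex
carrying that point, the matrix `r i * a i j` has row sums `r i` and column sums `y j`, and a
nonzero `a i j` means that labeling `i` uses label `j` there. For (1) take `y = 1` and `r i = k i -
1 + 1 / m`: entries are at most 1 and row `i` sums to more than `k i - 1`, so it has at least `k i`
nonzero entries. For (2) exchange the roles of rows and columns.

To attain `y`, cover the simplex by the closed sets where `G j ≤ y j`. A KKM-type theorem gives a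
point lying in the `j`-th set whenever its `j`-th coordinate is nonzero; when that coordinate
vanishes, the Sperner condition gives `G j = 0`. So `G ≤ y`, and equal sums force equality. The
covering theorem is a limit of its grid version, which follows from Scarf's lemma, itself proved by
a parity count. -/

namespace MultiSperner

/-! ### Scarf's lemma by double counting -/

section Scarf

variable {ι V α : Type*} [LinearOrder α]

/-- With respect to the family of preorders induced by `f`, every point is below the whole of `R`
for at least one of them. -/
def Dominant (f : ι → V → α) (R : Finset V) : Prop :=
  ∀ y, ∃ i, ∀ x ∈ R, f i y ≤ f i x

theorem Dominant.mono {f : ι → V → α} {R S : Finset V} (h : Dominant f R) (hS : S ⊆ R) :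
    Dominant f S := fun y ↦ (h y).imp fun _ hi x hx ↦ hi x (hS hx)

variable [Fintype ι] [DecidableEq ι] [DecidableEq V]

/-- If all colours occur, only the element of colour `i₀` can be removed. Otherwise a removable
element shares its colour with exactly one other, and precisely these two are removable. -/
theorem odd_card_erase_iff (c : V → ι) (i₀ : ι) {R : Finset V} (hR : R.card = Fintype.card ι) :
    Odd (R.filter fun x ↦ (R.erase x).image c = Finset.univ.erase i₀).card ↔
      R.image c = Finset.univ := by
  constructor
  · intro hodd
    by_contra hne
    obtain ⟨x, hx⟩ := Finset.card_pos.1 hodd.pos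
    obtain ⟨hxR, hx⟩ := Finset.mem_filter.1 hx
    have hinj : Set.InjOn c (R.erase x : Finset V) := Finset.card_image_iff.1 <| by
      rw [hx, Finset.card_erase_of_mem hxR, Finset.card_erase_of_mem (Finset.mem_univ _), hR,
        Finset.card_univ]
    have hcx : c x ≠ i₀ := by
      intro h
      apply hne
      rw [← Finset.insert_erase hxR, Finset.image_insert, hx, h,
        Finset.insert_erase (Finset.mem_univ _)]
    have hmem : c x ∈ (R.erase x).image c := by simp [hx, hcx]
    obtain ⟨x', hx', hcx'⟩ := Finset.mem_image.1 hmem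
    have hxx' : x' ≠ x := Finset.ne_of_mem_erase hx'
    have hx'R := Finset.mem_of_mem_erase hx'
    suffices R.filter (fun x ↦ (R.erase x).image c = Finset.univ.erase i₀) = {x, x'} by
      rw [this, Finset.card_pair hxx'.symm] at hodd
      exact absurd hodd (by decide)
    ext z
    simp only [Finset.mem_filter, Finset.mem_insert, Finset.mem_singleton]
    constructor
    · rintro ⟨hz, hzc⟩
      by_contra! hzx
      have hzinj : Set.InjOn c (R.erase z : Finset V) := Finset.card_image_iff.1 <| by
        rw [hzc, Finset.card_erase_of_mem hz, Finset.card_erase_of_mem (Finset.mem_univ _), hR,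
          Finset.card_univ]
      exact hxx' (hzinj (by simp [hx'R, hzx.2.symm]) (by simp [hxR, hzx.1.symm]) hcx')
    · rintro (rfl | rfl)
      · exact ⟨hxR, hx⟩
      · refine ⟨hx'R, ?_⟩
        rw [← hx]
        have h1 : R.erase z = insert x ((R.erase x).erase z) := by
          rw [Finset.erase_right_comm, Finset.insert_erase]
          simp [hxR, hxx'.symm]
        have h2 : R.erase x = insert z ((R.erase x).erase z) := (Finset.insert_erase hx').symm
        rw [h1, Finset.image_insert]
        conv_rhs => rw [h2]
        rw [Finset.image_insert, hcx']
  · intro h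
    have hinj : Set.InjOn c R := Finset.card_image_iff.1 <| by rw [h, hR, Finset.card_univ]
    obtain ⟨x, hxR, hx⟩ := Finset.mem_image.1 (h ▸ Finset.mem_univ i₀)
    suffices R.filter (fun x ↦ (R.erase x).image c = Finset.univ.erase i₀) = {x} by
      rw [this]; simp
    ext z
    simp only [Finset.mem_filter, Finset.mem_singleton]
    constructor
    · rintro ⟨hz, hzc⟩
      by_contra hzx
      have : i₀ ∈ (R.erase z).image c :=
        Finset.mem_image.2 ⟨x, by simp [hxR, Ne.symm hzx], hx⟩
      simp [hzc] at this
    · rintro rfl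
      refine ⟨hxR, ?_⟩
      ext i
      simp only [Finset.mem_image, Finset.mem_erase, Finset.mem_univ, and_true]
      constructor
      · rintro ⟨y, ⟨hyz, hy⟩, rfl⟩ hi
        exact hyz (hinj hy hxR (hi.trans hx.symm))
      · intro hi
        obtain ⟨y, hy, rfl⟩ := Finset.mem_image.1 (h ▸ Finset.mem_univ i)
        exact ⟨y, ⟨fun h' ↦ hi (h' ▸ hx), hy⟩, rfl⟩

variable [Fintype V]

/-- A dominant set with one element less than there are preorders, and not consisting of slack
elements only, has exactly two dominant one-point extensions. -/
theorem Dominant.exists_pair_extensions {f : ι → V → α} (hf : ∀ i, Function.Injective (f i))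
    {τ : Finset V} (hτ : Dominant f τ) (hcard : τ.card + 1 = Fintype.card ι) {v : V} (hv : v ∈ τ)
    {s : ι → V} (hs : ∀ i j, i ≠ j → f i v < f i (s j)) :
    ∃ a b : V, a ≠ b ∧ ∀ x, (x ∉ τ ∧ Dominant f (insert x τ)) ↔ x = a ∨ x = b := by
  have hne : τ.Nonempty := ⟨v, hv⟩
  choose m hm hmin using fun d ↦ Finset.exists_min_image τ (f d) hne
  -- Dominance at `x` itself makes `x` the minimum of `τ` in some order. With one element fewer than
  -- orders, `m` therefore has exactly one collision, `m i = m j`.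
  have hsurj : ∀ x ∈ τ, ∃ d, m d = x := by
    intro x hx
    obtain ⟨d, hd⟩ := hτ x
    exact ⟨d, hf d (le_antisymm (hmin d x hx) (hd _ (hm d)))⟩
  obtain ⟨i, -, j, -, hij, hmij⟩ := Finset.exists_ne_map_eq_of_card_lt_of_maps_to
    (s := Finset.univ) (t := τ) (f := m) (by rw [Finset.card_univ]; omega) (fun d _ ↦ hm d)
  have hgood : ∀ k, (∀ x ∈ τ, ∃ d, d ≠ k ∧ m d = x) ↔ k = i ∨ k = j := by
    intro k
    constructor
    · intro h
      by_contra! hk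
      have hinj : Set.InjOn m (Finset.univ.erase k : Finset ι) :=
        Finset.injOn_of_surjOn_of_card_le (t := τ) m (fun d _ ↦ hm d)
          (fun x hx ↦ by
            obtain ⟨d, hd, rfl⟩ := h x hx
            exact ⟨d, by simpa using hd, rfl⟩)
          (by rw [Finset.card_erase_of_mem (Finset.mem_univ _), Finset.card_univ]; omega)
      exact hij (hinj (by simpa using hk.1.symm) (by simpa using hk.2.symm) hmij)
    · intro h x hx
      obtain ⟨d, rfl⟩ := hsurj x hx
      rcases h with rfl | rfl
      · by_cases hd : d = k
        · exact ⟨j, hij.symm, by rw [hd, hmij]⟩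
        · exact ⟨d, hd, rfl⟩
      · by_cases hd : d = k
        · exact ⟨i, hij, by rw [hd, hmij]⟩
        · exact ⟨d, hd, rfl⟩
  -- An element taking over as minimum in order `k` must lie above the old minima in all other
  -- orders; dominance forces it to be `k`-maximal among such elements. The slack element `s k`
  -- shows that there are some.
  have hmax : ∀ k, ∃ x, (∀ d, d ≠ k → f d (m d) < f d x) ∧
      ∀ y, (∀ d, d ≠ k → f d (m d) < f d y) → f k y ≤ f k x := by
    intro k
    obtain ⟨x, hx, hxmax⟩ := Finset.exists_max_image
      (Finset.univ.filter fun x ↦ ∀ d, d ≠ k → f d (m d) < f d x) (f k)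
      ⟨s k, by simpa using fun d hd ↦ (hmin d v hv).trans_lt (hs d k hd)⟩
    exact ⟨x, by simpa using hx, fun y hy ↦ hxmax y (by simpa using hy)⟩
  choose b hb hbmax using hmax
  have hext : ∀ k, (k = i ∨ k = j) → b k ∉ τ ∧ Dominant f (insert (b k) τ) := by
    intro k hk
    refine ⟨fun hmem ↦ ?_, fun y ↦ ?_⟩
    · obtain ⟨d, hd, hdb⟩ := (hgood k).2 hk _ hmem
      exact (hb k d hd).ne (by rw [hdb])
    · by_cases hy : ∀ d, d ≠ k → f d (m d) < f d y
      · refine ⟨k, fun x hx ↦ ?_⟩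
        rcases Finset.mem_insert.1 hx with rfl | hx
        · exact hbmax k y hy
        · obtain ⟨d, hd⟩ := hτ y
          have hdk : d = k := by
            by_contra hdk
            exact (hy d hdk).not_ge (hd _ (hm d))
          exact hdk ▸ hd x hx
      · push Not at hy
        obtain ⟨d, hdk, hd⟩ := hy
        refine ⟨d, fun x hx ↦ ?_⟩
        rcases Finset.mem_insert.1 hx with rfl | hx
        · exact hd.trans (hb k d hdk).le
        · exact hd.trans (hmin d x hx)
  refine ⟨b i, b j, fun h ↦ ?_, fun x ↦ ⟨fun ⟨hxτ, hx⟩ ↦ ?_, ?_⟩⟩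
  · obtain ⟨d, hd⟩ := hτ (b i)
    have := hd _ (hm d)
    by_cases hdi : d = i
    · have h2 := hb j d (hdi ▸ hij)
      rw [← h] at h2
      exact h2.not_ge this
    · exact (hb i d hdi).not_ge this
  -- `D` is a bijection from `insert x τ` onto the orders, and `D x` is the order that `x` takes
  -- over.
  · choose D hD using hx
    have hDinj : Set.InjOn D (insert x τ : Finset V) := by
      intro y hy z hz hyz
      refine hf (D y) (le_antisymm (hD y z hz) ?_)
      rw [hyz]
      exact hD z y hy
    have hDsurj : ∀ d, ∃ z ∈ insert x τ, D z = d := by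
      intro d
      have := Finset.surjOn_of_injOn_of_card_le (s := insert x τ) (t := Finset.univ) D
        (fun _ _ ↦ by simp) hDinj
        (by rw [Finset.card_univ, Finset.card_insert_of_notMem hxτ]; omega)
      exact this (by simp)
    have hDτ : ∀ z ∈ τ, D z ≠ D x := fun z hz h ↦ hxτ <| by
      rwa [← hDinj (by simp [hz]) (by simp) h]
    have hDm : ∀ z ∈ τ, m (D z) = z := fun z hz ↦
      hf (D z) (le_antisymm (hmin _ z hz) (hD z _ (by simp [hm])))
    have hk := (hgood (D x)).1 fun z hz ↦ ⟨D z, hDτ z hz, hDm z hz⟩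
    have hlt : ∀ d, d ≠ D x → f d (m d) < f d x := by
      intro d hd
      obtain ⟨z, hz, rfl⟩ := hDsurj d
      have hzτ : z ∈ τ := by
        rcases Finset.mem_insert.1 hz with rfl | hz
        · exact absurd rfl hd
        · exact hz
      rw [hDm z hzτ]
      refine lt_of_le_of_ne (hD z x (by simp)) fun h ↦ hxτ ?_
      rwa [← hf _ h]
    have hxb : x = b (D x) := by
      refine hf (D x) (le_antisymm (hbmax _ x hlt) ?_)
      have hDb : D (b (D x)) = D x := by
        by_contra hne'
        exact (hb (D x) _ hne').not_ge (hD (b (D x)) _ (by simp [hm]))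
      have := hD (b (D x)) x (by simp)
      rwa [hDb] at this
    rcases hk with hk | hk
    · left; rwa [hk] at hxb
    · right; rwa [hk] at hxb
  · rintro (rfl | rfl)
    · exact hext i (.inl rfl)
    · exact hext j (.inr rfl)

/-- A form of Scarf's lemma. -/
theorem exists_dominant_colorful {f : ι → V → α} (hf : ∀ i, Function.Injective (f i))
    {s : ι → V} (hbot : ∀ i v, v ≠ s i → f i (s i) < f i v)
    (htop : ∀ v, v ∉ Set.range s → ∀ i j, i ≠ j → f i v < f i (s j))
    (hV : ∃ v, v ∉ Set.range s) [Nonempty ι] {c : V → ι} (hc : ∀ i, c (s i) = i) :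
    ∃ R : Finset V, R.card = Fintype.card ι ∧ Dominant f R ∧ R.image c = Finset.univ := by
  classical
  obtain ⟨i₀⟩ := ‹Nonempty ι›
  have hs : Function.Injective s := fun i j h ↦ by rw [← hc i, h, hc]
  let rooms : Finset (Finset V) :=
    Finset.univ.filter fun R ↦ R.card = Fintype.card ι ∧ Dominant f R
  let doors : Finset (Finset V) := Finset.univ.filter fun τ ↦
    τ.card + 1 = Fintype.card ι ∧ Dominant f τ ∧ τ.image c = Finset.univ.erase i₀
  let r : Finset V → Finset V → Prop := fun R τ ↦ τ ⊆ R
  have hroom : ∀ R ∈ rooms, (doors.bipartiteAbove r R).card =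
      (R.filter fun x ↦ (R.erase x).image c = Finset.univ.erase i₀).card := by
    intro R hR
    obtain ⟨-, hRc, hRd⟩ := Finset.mem_filter.1 hR
    symm
    refine Finset.card_bij (fun x _ ↦ R.erase x) ?_ ?_ ?_
    · intro x hx
      obtain ⟨hxR, hx⟩ := Finset.mem_filter.1 hx
      have := Finset.card_erase_add_one hxR
      simp only [Finset.mem_bipartiteAbove, doors, r, Finset.mem_filter, Finset.mem_univ, true_and]
      exact ⟨⟨by omega, hRd.mono (Finset.erase_subset _ _), hx⟩, Finset.erase_subset _ _⟩
    · intro x hx y hy hxy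
      exact Finset.erase_injOn R (Finset.mem_filter.1 hx).1 (Finset.mem_filter.1 hy).1 hxy
    · intro τ hτ
      simp only [Finset.mem_bipartiteAbove, doors, r, Finset.mem_filter, Finset.mem_univ,
        true_and] at hτ
      obtain ⟨⟨hτc, -, hτi⟩, hτR⟩ := hτ
      obtain ⟨x, hxτ, rfl⟩ := (Finset.exists_eq_insert_iff (s := τ) (t := R)).2 ⟨hτR, by omega⟩
      have : (insert x τ).erase x = τ := Finset.erase_insert hxτ
      exact ⟨x, by simp [this, hτi], this⟩
  have hdoor : ∀ τ ∈ doors, (rooms.bipartiteBelow r τ).card =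
      (Finset.univ.filter fun x ↦ x ∉ τ ∧ Dominant f (insert x τ)).card := by
    intro τ hτ
    obtain ⟨-, hτc, hτd, hτi⟩ := Finset.mem_filter.1 hτ
    symm
    refine Finset.card_bij (fun x _ ↦ insert x τ) ?_ ?_ ?_
    · intro x hx
      obtain ⟨-, hxτ, hx⟩ := Finset.mem_filter.1 hx
      simp only [Finset.mem_bipartiteBelow, rooms, r, Finset.mem_filter, Finset.mem_univ, true_and]
      exact ⟨⟨by rw [Finset.card_insert_of_notMem hxτ, hτc], hx⟩, Finset.subset_insert _ _⟩
    · intro x hx y hy hxy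
      obtain ⟨-, hxτ, hx⟩ := Finset.mem_filter.1 hx
      exact (Finset.insert_inj hxτ).1 hxy
    · intro R hR
      simp only [Finset.mem_bipartiteBelow, rooms, r, Finset.mem_filter, Finset.mem_univ,
        true_and] at hR
      obtain ⟨⟨hRc, hRd⟩, hτR⟩ := hR
      obtain ⟨x, hxτ, rfl⟩ := (Finset.exists_eq_insert_iff (s := τ) (t := R)).2 ⟨hτR, by omega⟩
      exact ⟨x, by simp [hxτ, hRd], rfl⟩
  -- The one boundary door: it lies in a single room, every other door in two.
  let τ₀ : Finset V := (Finset.univ.erase i₀).image s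
  have hτ₀c : τ₀.card + 1 = Fintype.card ι := by
    rw [Finset.card_image_of_injective _ hs, Finset.card_erase_add_one (Finset.mem_univ _),
      Finset.card_univ]
  have hτ₀mem : ∀ x, x ∈ τ₀ ↔ ∃ i, i ≠ i₀ ∧ s i = x := by simp [τ₀]
  have hbot' : ∀ i v, f i (s i) ≤ f i v := fun i v ↦ by
    by_cases h : v = s i
    · rw [h]
    · exact (hbot i v h).le
  have hτ₀ : τ₀ ∈ doors := by
    refine Finset.mem_filter.2 ⟨Finset.mem_univ _, hτ₀c, fun y ↦ ?_, ?_⟩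
    · by_cases hy : y ∈ Set.range s
      · obtain ⟨i, rfl⟩ := hy
        exact ⟨i, fun x _ ↦ hbot' i x⟩
      · refine ⟨i₀, fun x hx ↦ ?_⟩
        obtain ⟨i, hi, rfl⟩ := (hτ₀mem x).1 hx
        exact (htop y hy i₀ i hi.symm).le
    · simp only [τ₀, Finset.image_image]
      rw [show c ∘ s = id from funext hc, Finset.image_id]
  have hodd₀ : Odd (rooms.bipartiteBelow r τ₀).card := by
    rw [hdoor τ₀ hτ₀]
    obtain ⟨w, hw⟩ := hV
    obtain ⟨v, hv, hvmax⟩ := Finset.exists_max_image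
      (Finset.univ.filter fun v ↦ v ∉ Set.range s) (f i₀) ⟨w, by simpa using hw⟩
    replace hv : v ∉ Set.range s := (Finset.mem_filter.1 hv).2
    replace hvmax : ∀ y, y ∉ Set.range s → f i₀ y ≤ f i₀ v := fun y hy ↦
      hvmax y (Finset.mem_filter.2 ⟨Finset.mem_univ _, hy⟩)
    suffices (Finset.univ.filter fun x ↦ x ∉ τ₀ ∧ Dominant f (insert x τ₀)) = {v} by
      rw [this]; simp
    ext x
    simp only [Finset.mem_filter, Finset.mem_univ, true_and, Finset.mem_singleton]
    constructor
    · rintro ⟨hxτ, hx⟩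
      obtain ⟨i, hi⟩ := hx v
      obtain rfl : i = i₀ := by
        by_contra hne
        have := hi (s i) (Finset.mem_insert_of_mem ((hτ₀mem _).2 ⟨i, hne, rfl⟩))
        exact (hbot i v fun h ↦ hv ⟨i, h.symm⟩).not_ge this
      have hvx := hi x (Finset.mem_insert_self _ _)
      have hxs : x ∉ Set.range s := by
        rintro ⟨j, rfl⟩
        by_cases hj : j = i
        · subst hj
          exact (hbot j v fun h ↦ hv ⟨j, h.symm⟩).not_ge hvx
        · exact hxτ ((hτ₀mem _).2 ⟨j, hj, rfl⟩)
      exact hf _ (le_antisymm (hvmax x hxs) hvx)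
    · rintro rfl
      refine ⟨fun h ↦ ?_, fun y ↦ ?_⟩
      · obtain ⟨i, -, rfl⟩ := (hτ₀mem x).1 h
        exact hv ⟨i, rfl⟩
      · by_cases hy : y ∈ Set.range s
        · obtain ⟨i, rfl⟩ := hy
          exact ⟨i, fun x _ ↦ hbot' i x⟩
        · refine ⟨i₀, fun z hz ↦ ?_⟩
          rcases Finset.mem_insert.1 hz with rfl | hz
          · exact hvmax y hy
          · obtain ⟨i, hi, rfl⟩ := (hτ₀mem z).1 hz
            exact (htop y hy i₀ i hi.symm).le
  have heven : ∀ τ ∈ doors, τ ≠ τ₀ → Even (rooms.bipartiteBelow r τ).card := by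
    intro τ hτ hne
    rw [hdoor τ hτ]
    obtain ⟨-, hτc, hτd, hτi⟩ := Finset.mem_filter.1 hτ
    -- A door of slack elements only lacks colour `i₀`, hence is `τ₀`.
    have hexv : ∃ v ∈ τ, v ∉ Set.range s := by
      by_contra! h
      refine hne (Finset.eq_of_subset_of_card_le (fun x hx ↦ ?_) (by omega))
      obtain ⟨i, rfl⟩ := h x hx
      refine (hτ₀mem _).2 ⟨i, ?_, rfl⟩
      have : c (s i) ∈ τ.image c := Finset.mem_image_of_mem c hx
      rw [hτi, hc] at this
      exact Finset.ne_of_mem_erase this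
    obtain ⟨v, hv, hvs⟩ := hexv
    obtain ⟨a, b, hab, h⟩ := hτd.exists_pair_extensions hf hτc hv (htop v hvs)
    have : (Finset.univ.filter fun x ↦ x ∉ τ ∧ Dominant f (insert x τ)) = {a, b} := by
      ext x; simp [h]
    rw [this, Finset.card_pair hab]
    exact even_two
  have hsum : Odd (∑ R ∈ rooms, (doors.bipartiteAbove r R).card) := by
    rw [Finset.sum_card_bipartiteAbove_eq_sum_card_bipartiteBelow,
      ← Finset.add_sum_erase _ _ hτ₀]
    refine hodd₀.add_even (Finset.even_sum _ fun τ hτ ↦ ?_)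
    exact heven τ (Finset.mem_of_mem_erase hτ) (Finset.ne_of_mem_erase hτ)
  by_contra! hno
  refine (Nat.not_even_iff_odd.2 hsum) (Finset.even_sum _ fun R hR ↦ ?_)
  obtain ⟨-, hRc, hRd⟩ := Finset.mem_filter.1 hR
  rw [hroom R hR, ← Nat.not_odd_iff_even, odd_card_erase_iff c i₀ hRc]
  exact hno R hRc hRd

end Scarf


/-! ### A KKM-type theorem from Scarf's lemma -/

section Covering

open Filter Topology

variable {ι : Type*} [Fintype ι]

/-- Among the points of the grid `{a : ι → ℕ | ∑ i, a i = N}`, covered by the sets `P i`, there is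
one that, for every `i`, is close to a point of `P i` or has a small `i`-th coordinate. -/
theorem exists_grid_point [Nonempty ι] (N : ℕ) (P : ι → (ι → ℕ) → Prop)
    (hP : ∀ a : ι → ℕ, ∑ i, a i = N → ∃ i, P i a) :
    ∃ a : ι → ℕ, ∑ i, a i = N ∧ ∀ i, a i ≤ Fintype.card ι ∨
      ∃ b : ι → ℕ, ∑ i, b i = N ∧ P i b ∧
        ∀ j, a j ≤ b j + Fintype.card ι ∧ b j ≤ a j + Fintype.card ι := by
  classical
  let I := {a : ι → ℕ // a ∈ Finset.univ.piAntidiag N}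
  have hI : ∀ a : I, ∑ i, a.1 i = N := fun a ↦ (Finset.mem_piAntidiag.1 a.2).1
  have mkI : ∀ a : ι → ℕ, ∑ i, a i = N → ∃ b : I, b.1 = a := fun a ha ↦
    ⟨⟨a, Finset.mem_piAntidiag.2 ⟨ha, by simp⟩⟩, rfl⟩
  let V := I ⊕ ι
  have : Fintype I := Finset.fintypeCoeSort _
  have : Fintype V := instFintypeSum I ι
  let e := Fintype.equivFin V
  -- Grid values lie in `1, …, N + 1`, so 0 puts a slack element below them in its own order and `N
  -- + 2` above them in the others. The enumeration `e` breaks ties.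
  let X : ι → V → ℕ := fun i ↦ Sum.elim (fun a ↦ a.1 i + 1) fun j ↦ if i = j then 0 else N + 2
  let f : ι → V → ℕ ×ₗ Fin (Fintype.card V) := fun i v ↦ toLex (X i v, e v)
  have hf : ∀ i, Function.Injective (f i) := fun i v w h ↦
    e.injective (congrArg Prod.snd (toLex.injective h))
  have hlt : ∀ i v w, X i v < X i w → f i v < f i w := fun i v w h ↦
    Prod.Lex.toLex_lt_toLex.2 (.inl h)
  have hle : ∀ i v w, f i v ≤ f i w → X i v ≤ X i w := fun i v w h ↦ by
    by_contra! h'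
    exact (hlt i w v h').not_ge h
  have hIle : ∀ (a : I) i, a.1 i ≤ N := fun a i ↦
    (Finset.single_le_sum (f := a.1) (fun _ _ ↦ Nat.zero_le _) (Finset.mem_univ i)).trans_eq (hI a)
  choose c hc using fun a : I ↦ hP a.1 (hI a)
  obtain ⟨i₀⟩ := id ‹Nonempty ι›
  obtain ⟨a₀, -⟩ := mkI (Pi.single i₀ N) (by simp)
  obtain ⟨R, hRc, hRd, hRi⟩ := exists_dominant_colorful (f := f) (s := Sum.inr)
    (c := Sum.elim c id) hf
    (by
      rintro i (a | j) h
      · exact hlt _ _ _ (by simp [X])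
      · have : i ≠ j := fun h' ↦ h (by rw [h'])
        exact hlt _ _ _ (by simp [X, this]))
    (by
      rintro (a | j) h i k hik
      · exact hlt _ _ _ (by have := hIle a i; simp [X, hik]; omega)
      · exact absurd ⟨j, rfl⟩ h)
    ⟨Sum.inl a₀, by simp⟩ (fun _ ↦ rfl)
  let C : Finset ι := Finset.univ.filter fun i ↦ (Sum.inr i : V) ∉ R
  let A : Finset I := Finset.univ.filter fun a ↦ (Sum.inl a : V) ∈ R
  have hA : ∀ a, a ∈ A ↔ (Sum.inl a : V) ∈ R := by simp [A]
  have hdom : ∀ b : I, ∃ i ∈ C, ∀ a ∈ A, b.1 i ≤ a.1 i := by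
    intro b
    obtain ⟨i, hi⟩ := hRd (Sum.inl b)
    refine ⟨i, ?_, fun a ha ↦ ?_⟩
    · simp only [C, Finset.mem_filter, Finset.mem_univ, true_and]
      intro h
      have := hle _ _ _ (hi _ h)
      simp [X] at this
    · have := hle _ _ _ (hi _ ((hA a).1 ha))
      simpa [X] using this
  have hCA : ∀ i ∈ C, ∃ a ∈ A, P i a.1 := by
    intro i hi
    obtain ⟨v, hv, rfl⟩ := Finset.mem_image.1 (hRi ▸ Finset.mem_univ i)
    rcases v with a | j
    · exact ⟨a, (hA a).2 hv, hc a⟩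
    · exact absurd hv (Finset.mem_filter.1 hi).2
  obtain ⟨i₁, hi₁, -⟩ := hdom a₀
  obtain ⟨a, ha, -⟩ := hCA i₁ hi₁
  choose μ hμA hμ using fun i ↦ Finset.exists_min_image A (fun b ↦ b.1 i) ⟨a, ha⟩
  -- Otherwise some grid point would exceed the minima over `A` in every coordinate of `C`, against
  -- dominance.
  have hsum : N < ∑ i ∈ C, ((μ i).1 i + 1) := by
    by_contra! h
    obtain ⟨b, hb⟩ := mkI (fun i ↦ (if i ∈ C then (μ i).1 i + 1 else 0) +
      Pi.single (M := fun _ ↦ ℕ) i₁ (N - ∑ i ∈ C, ((μ i).1 i + 1)) i) (by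
        rw [Finset.sum_add_distrib, Finset.sum_pi_single', Finset.sum_ite_mem]
        simp only [Finset.univ_inter, Finset.mem_univ, if_true]
        omega)
    obtain ⟨i, hi, hbi⟩ := hdom b
    have := hbi _ (hμA i)
    simp only [hb, hi, if_true] at this
    omega
  have hC : ∑ i ∈ C, ((μ i).1 i + 1) ≤ ∑ i ∈ C, (μ i).1 i + Fintype.card ι := by
    rw [Finset.sum_add_distrib]
    simpa using Finset.card_le_univ C
  -- The minima have total at least `N` minus the number of coordinates, so no coordinate can exceed
  -- its minimum by more than that number.
  have hnear : ∀ b ∈ A, ∀ j, b.1 j ≤ (if j ∈ C then (μ j).1 j else 0) + Fintype.card ι := by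
    intro b hb j
    have h1 : ∀ i, (if i ∈ C then (μ i).1 i else 0) ≤ b.1 i := fun i ↦ by
      split_ifs
      · exact hμ i b hb
      · exact Nat.zero_le _
    have h2 : ∑ i ∈ Finset.univ.erase j, (if i ∈ C then (μ i).1 i else 0) ≤
        ∑ i ∈ Finset.univ.erase j, b.1 i := Finset.sum_le_sum fun i _ ↦ h1 i
    have h3 := Finset.add_sum_erase Finset.univ b.1 (Finset.mem_univ j)
    have h4 := Finset.add_sum_erase Finset.univ (fun i ↦ if i ∈ C then (μ i).1 i else 0)
      (Finset.mem_univ j)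
    have h5 := Finset.sum_ite_mem Finset.univ C fun i ↦ (μ i).1 i
    rw [Finset.univ_inter] at h5
    rw [hI b] at h3
    omega
  have hmin : ∀ b ∈ A, ∀ j, (if j ∈ C then (μ j).1 j else 0) ≤ b.1 j := fun b hb j ↦ by
    split_ifs
    · exact hμ j b hb
    · exact Nat.zero_le _
  refine ⟨a.1, hI a, fun i ↦ ?_⟩
  by_cases hi : i ∈ C
  · obtain ⟨b, hb, hbP⟩ := hCA i hi
    refine .inr ⟨b.1, hI b, hbP, fun j ↦ ?_⟩
    have := hnear a ha j
    have := hnear b hb j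
    have := hmin a ha j
    have := hmin b hb j
    omega
  · have := hnear a ha i
    rw [if_neg hi] at this
    exact .inl (by omega)

/-- A covering theorem of Knaster–Kuratowski–Mazurkiewicz type, without boundary condition. -/
theorem exists_mem_stdSimplex_of_cover [Nonempty ι] (A : ι → Set (ι → ℝ))
    (hA : ∀ i, IsClosed (A i)) (hcover : ∀ x ∈ stdSimplex ℝ ι, ∃ i, x ∈ A i) :
    ∃ x ∈ stdSimplex ℝ ι, ∀ i, x i ≠ 0 → x ∈ A i := by
  let q : ℕ → (ι → ℕ) → ι → ℝ := fun N a i ↦ (a i : ℝ) / (N + 1 : ℝ)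
  have hq : ∀ N a, ∑ i, a i = N + 1 → q N a ∈ stdSimplex ℝ ι := by
    intro N a ha
    refine ⟨fun i ↦ by positivity, ?_⟩
    rw [← Finset.sum_div, ← Nat.cast_sum, ha]
    push_cast
    exact div_self (by positivity)
  choose a ha hab using fun N ↦ exists_grid_point (N + 1) (fun i a ↦ q N a ∈ A i)
    (fun a ha ↦ hcover _ (hq N a ha))
  obtain ⟨x, hx, φ, hφ, hlim⟩ := (isCompact_stdSimplex ℝ ι).tendsto_subseq
    (fun N ↦ hq N (a N) (ha N))
  refine ⟨x, hx, fun i hxi ↦ ?_⟩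
  have hpos : 0 < x i := (hx.1 i).lt_of_ne hxi.symm
  have hsmall : Tendsto (fun N ↦ (Fintype.card ι : ℝ) / ((φ N : ℝ) + 1)) atTop (𝓝 0) :=
    (tendsto_const_div_atTop_nhds_zero_nat (Fintype.card ι : ℝ)).comp
      ((tendsto_add_atTop_nat 1).comp hφ.tendsto_atTop) |>.congr fun N ↦ by simp
  rw [← (hA i).closure_eq, Metric.mem_closure_iff]
  intro ε hε
  have h1 := (hlim.eventually (Metric.ball_mem_nhds x (half_pos hε)))
  have h2 := hsmall.eventually (gt_mem_nhds (half_pos hε))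
  -- Positivity of `x i` eventually rules out the small-coordinate alternative.
  have h3 : ∀ᶠ N in atTop, (Fintype.card ι : ℝ) / ((φ N : ℝ) + 1) < q (φ N) (a (φ N)) i :=
    hsmall.eventually_lt ((tendsto_pi_nhds.1 hlim) i) hpos
  obtain ⟨N, hN1, hN2, hN3⟩ := (h1.and (h2.and h3)).exists
  have hN : (0 : ℝ) < (φ N : ℝ) + 1 := by positivity
  rcases hab (φ N) i with h | ⟨b, -, hbA, hb⟩
  · exfalso
    rw [div_lt_div_iff_of_pos_right hN] at hN3
    exact absurd h (by exact_mod_cast hN3.not_ge)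
  · refine ⟨_, hbA, ?_⟩
    have hd : dist (q (φ N) (a (φ N))) (q (φ N) b) ≤ Fintype.card ι / ((φ N : ℝ) + 1) := by
      rw [dist_pi_le_iff (by positivity)]
      intro j
      rw [Real.dist_eq, ← sub_div, abs_div, abs_of_pos hN]
      gcongr
      have h1 : (a (φ N) j : ℝ) ≤ b j + Fintype.card ι := by exact_mod_cast (hb j).1
      have h2 : (b j : ℝ) ≤ a (φ N) j + Fintype.card ι := by exact_mod_cast (hb j).2
      rw [abs_le]
      constructor <;> linarith
    calc dist x (q (φ N) b) ≤ dist x (q (φ N) (a (φ N))) + _ := dist_triangle _ _ _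
      _ < ε / 2 + ε / 2 := add_lt_add_of_lt_of_le (by rw [dist_comm]; exact hN1)
          (hd.trans hN2.le)
      _ = ε := add_halves ε

end Covering


/-! ### Barycentric weights on a simplicial complex -/

section Geometry

variable {E : Type*} [NormedAddCommGroup E] [InnerProductSpace ℝ E]

theorem mem_convexHull_range_iff {ι : Type*} [Fintype ι] (p : ι → E) {x : E} :
    x ∈ convexHull ℝ (Set.range p) ↔ ∃ t ∈ stdSimplex ℝ ι, ∑ i, t i • p i = x := by
  classical
  constructor
  · intro hx
    rw [show Set.range p = Fintype.linearCombination ℝ p '' Set.range fun i ↦ Pi.single i 1 by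
      rw [← Set.range_comp]; congr 1; ext i; simp [Fintype.linearCombination_apply_single],
      ← LinearMap.image_convexHull, convexHull_rangle_single_eq_stdSimplex] at hx
    exact hx
  · rintro ⟨t, ht, rfl⟩
    exact (convex_convexHull ℝ _).sum_mem (fun i _ ↦ ht.1 i) ht.2
      fun i _ ↦ subset_convexHull ℝ _ ⟨i, rfl⟩

theorem eq_of_sum_smul_eq {ι : Type*} [Fintype ι] {p : ι → E} (hp : AffineIndependent ℝ p)
    {t u : ι → ℝ} (h₁ : ∑ i, t i = ∑ i, u i) (h : ∑ i, t i • p i = ∑ i, u i • p i) : t = u := by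
  ext i
  refine sub_eq_zero.1 (affineIndependent_iff.1 hp Finset.univ (fun i ↦ t i - u i) ?_ ?_ i
    (Finset.mem_univ i))
  · rw [Finset.sum_sub_distrib, h₁, sub_self]
  · simp_rw [sub_smul]
    rw [Finset.sum_sub_distrib, h, sub_self]

variable {T : Geometry.SimplicialComplex ℝ E}

theorem mem_vertices_of_mem {σ : Finset E} (hσ : σ ∈ T.faces) {v : E} (hv : v ∈ σ) :
    v ∈ T.vertices :=
  T.down_closed hσ (Finset.singleton_subset_iff.2 hv) (Finset.singleton_nonempty v)

theorem finite_vertices (hT : T.faces.Finite) : T.vertices.Finite :=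
  hT.preimage Finset.singleton_injective.injOn

variable [Fintype T.vertices]

theorem sum_vertices_eq_sum_face {M : Type*} [AddCommMonoid M] {σ : Finset E} (hσ : σ ∈ T.faces)
    (g : T.vertices → M) (hg : ∀ v : T.vertices, (v : E) ∉ σ → g v = 0) :
    ∑ v, g v = ∑ y : σ, g ⟨y, mem_vertices_of_mem hσ y.2⟩ := by
  symm
  refine Finset.sum_of_injOn (fun y : σ ↦ (⟨y, mem_vertices_of_mem hσ y.2⟩ : T.vertices))
    (fun y _ z _ h ↦ Subtype.ext (congrArg (fun v : T.vertices ↦ (v : E)) h)) (by simp) ?_ ?_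
  · intro v _ hv
    refine hg v fun h ↦ hv ⟨⟨v, h⟩, by simp, rfl⟩
  · intro y _
    rfl

variable (T) in
/-- The systems of barycentric weights, on the vertices of `T`, that are supported by the
simplex `σ`. -/
def faceWeights (σ : Finset E) : Set (T.vertices → ℝ) :=
  {w ∈ stdSimplex ℝ T.vertices | ∀ v : T.vertices, (v : E) ∉ σ → w v = 0}

theorem isCompact_faceWeights (σ : Finset E) : IsCompact (faceWeights T σ) := by
  refine (isCompact_stdSimplex ℝ T.vertices).inter_right
    (t := {w : T.vertices → ℝ | ∀ v : T.vertices, (v : E) ∉ σ → w v = 0}) ?_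
  simp only [Set.ofPred_forall]
  exact isClosed_iInter fun v ↦ isClosed_iInter fun _ ↦
    isClosed_eq (continuous_apply v) continuous_const

theorem exists_faceWeights {σ : Finset E} (hσ : σ ∈ T.faces) {x : E}
    (hx : x ∈ convexHull ℝ (σ : Set E)) :
    ∃ w ∈ faceWeights T σ, ∑ v, w v • (v : E) = x := by
  classical
  obtain ⟨u, hu0, hu1, hux⟩ := Finset.mem_convexHull'.1 hx
  refine ⟨fun v ↦ if (v : E) ∈ σ then u v else 0, ⟨⟨fun v ↦ ?_, ?_⟩, fun v hv ↦ if_neg hv⟩, ?_⟩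
  · dsimp only
    split_ifs with h
    · exact hu0 _ h
    · exact le_rfl
  · rw [sum_vertices_eq_sum_face hσ _ fun v hv ↦ if_neg hv, ← hu1, ← Finset.sum_coe_sort σ]
    exact Finset.sum_congr rfl fun y _ ↦ if_pos y.2
  · rw [sum_vertices_eq_sum_face hσ _ fun v hv ↦ by simp only [if_neg hv, zero_smul], ← hux,
      ← Finset.sum_coe_sort σ]
    exact Finset.sum_congr rfl fun y _ ↦ by simp only [if_pos y.2]

theorem faceWeights_eq_of_mem {σ : Finset E} (hσ : σ ∈ T.faces) {w w' : T.vertices → ℝ}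
    (hw : w ∈ faceWeights T σ) (hw' : w' ∈ faceWeights T σ)
    (h : ∑ v, w v • (v : E) = ∑ v, w' v • (v : E)) : w = w' := by
  have hsum := hw.1.2.trans hw'.1.2.symm
  rw [sum_vertices_eq_sum_face hσ _ hw.2, sum_vertices_eq_sum_face hσ _ hw'.2] at hsum
  rw [sum_vertices_eq_sum_face hσ _ fun v hv ↦ by rw [hw.2 v hv, zero_smul],
    sum_vertices_eq_sum_face hσ _ fun v hv ↦ by rw [hw'.2 v hv, zero_smul]] at h
  have heq := eq_of_sum_smul_eq (T.indep hσ) hsum h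
  ext v
  by_cases hv : (v : E) ∈ σ
  · exact congrFun heq ⟨v, hv⟩
  · rw [hw.2 v hv, hw'.2 v hv]

/-- A point of two simplices has weights supported by their common face, and affine independence in
each simplex identifies both systems with these. Hence piecewise linear maps are well defined. -/
theorem faceWeights_eq {σ σ' : Finset E} (hσ : σ ∈ T.faces) (hσ' : σ' ∈ T.faces)
    {w w' : T.vertices → ℝ} (hw : w ∈ faceWeights T σ) (hw' : w' ∈ faceWeights T σ')
    (h : ∑ v, w v • (v : E) = ∑ v, w' v • (v : E)) : w = w' := by
  classical
  have hmem : ∀ {ρ : Finset E} {u : T.vertices → ℝ}, ρ ∈ T.faces → u ∈ faceWeights T ρ →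
      ∑ v, u v • (v : E) ∈ convexHull ℝ (ρ : Set E) := by
    intro ρ u hρ hu
    rw [sum_vertices_eq_sum_face hρ _ fun v hv ↦ by rw [hu.2 v hv, zero_smul]]
    refine (convex_convexHull ℝ _).sum_mem (fun y _ ↦ hu.1.1 _) ?_
      fun y _ ↦ subset_convexHull ℝ _ y.2
    rw [← sum_vertices_eq_sum_face hρ _ hu.2, hu.1.2]
  have hx := T.inter_subset_convexHull hσ hσ' ⟨hmem hσ hw, h ▸ hmem hσ' hw'⟩
  rw [← Finset.coe_inter] at hx
  have hne : (σ ∩ σ').Nonempty := Finset.coe_nonempty.1 (convexHull_nonempty_iff.1 ⟨_, hx⟩)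
  obtain ⟨u, hu, hux⟩ := exists_faceWeights
    (T.down_closed hσ Finset.inter_subset_left hne) hx
  have hu₁ : u ∈ faceWeights T σ :=
    ⟨hu.1, fun v hv ↦ hu.2 v fun h ↦ hv (Finset.mem_inter.1 h).1⟩
  have hu₂ : u ∈ faceWeights T σ' :=
    ⟨hu.1, fun v hv ↦ hu.2 v fun h ↦ hv (Finset.mem_inter.1 h).2⟩
  exact (faceWeights_eq_of_mem hσ hu₁ hw hux).symm.trans
    (faceWeights_eq_of_mem hσ' hu₂ hw' (hux.trans h))

end Geometry

/-! ### Averages of labelings and the counting of labels -/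

section Average

variable {E : Type*} [NormedAddCommGroup E] [InnerProductSpace ℝ E]

/-- A weighted average of the piecewise linear maps induced by Sperner labelings hits every point
of the simplex with positive coordinates. -/
theorem exists_face_average {n m : ℕ} (hn : 1 ≤ n) {p : Fin n → E} (hp : AffineIndependent ℝ p)
    {T : Geometry.SimplicialComplex ℝ E} (hT : IsTriangulation T (convexHull ℝ (Set.range p)))
    {lab : Fin m → T.vertices → Fin n} (hlab : ∀ i, IsSpernerLabeling p T (lab i))
    (r : Fin m → ℝ) {y : Fin n → ℝ} (hy : ∀ j, 0 < y j) (hry : ∑ i, r i = ∑ j, y j) :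
    ∃ σ ∈ T.faces, ∃ a : Fin m → Fin n → ℝ, (∀ i j, 0 ≤ a i j) ∧ (∀ i, ∑ j, a i j = 1) ∧
      (∀ j, ∑ i, r i * a i j = y j) ∧ ∀ i j, a i j ≠ 0 → j ∈ labelsOn (lab i) σ := by
  classical
  have : Fintype T.vertices := (finite_vertices hT.finite_faces).fintype
  have : Nonempty (Fin n) := ⟨⟨0, hn⟩⟩
  let π : (T.vertices → ℝ) → E := fun w ↦ ∑ v, w v • (v : E)
  let φ : (Fin n → ℝ) → E := fun t ↦ ∑ k, t k • p k
  let a : (T.vertices → ℝ) → Fin m → Fin n → ℝ := fun w i j ↦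
    ∑ v, if lab i v = j then w v else 0
  let G : (T.vertices → ℝ) → Fin n → ℝ := fun w j ↦ ∑ i, r i * a w i j
  have hπ : Continuous π := by fun_prop
  have hφ : Continuous φ := by fun_prop
  have hG : ∀ j, Continuous fun w ↦ G w j := by
    intro j
    refine continuous_finsetSum _ fun i _ ↦ continuous_const.mul
      (continuous_finsetSum _ fun v _ ↦ ?_)
    split_ifs
    · exact continuous_apply v
    · exact continuous_const
  have hasum : ∀ w ∈ stdSimplex ℝ T.vertices, ∀ i, ∑ j, a w i j = 1 := by
    intro w hw i
    rw [Finset.sum_comm, ← hw.2]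
    exact Finset.sum_congr rfl fun v _ ↦ by simp
  have hGsum : ∀ w ∈ stdSimplex ℝ T.vertices, ∑ j, G w j = ∑ j, y j := by
    intro w hw
    rw [Finset.sum_comm, ← hry]
    exact Finset.sum_congr rfl fun i _ ↦ by rw [← Finset.mul_sum, hasum w hw, mul_one]
  let A : Fin n → Set (Fin n → ℝ) := fun j ↦
    φ ⁻¹' ⋃ σ ∈ T.faces, π '' (faceWeights T σ ∩ {w | G w j ≤ y j})
  have hAclosed : ∀ j, IsClosed (A j) := fun j ↦
    (hT.finite_faces.isClosed_biUnion fun σ _ ↦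
      (((isCompact_faceWeights σ).inter_right
        (isClosed_le (hG j) continuous_const)).image hπ).isClosed).preimage hφ
  have hmemA : ∀ {t j}, t ∈ A j ↔
      ∃ σ ∈ T.faces, ∃ w ∈ faceWeights T σ, G w j ≤ y j ∧ π w = φ t := by
    intro t j
    simp only [A, Set.mem_preimage, Set.mem_iUnion, Set.mem_image, Set.mem_inter_iff,
      Set.mem_ofPred_eq, exists_prop, and_assoc]
  have hlift : ∀ t ∈ stdSimplex ℝ (Fin n), ∃ σ ∈ T.faces, ∃ w ∈ faceWeights T σ, π w = φ t := by
    intro t ht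
    have hx : φ t ∈ T.space := by
      rw [hT.space_eq]
      exact (mem_convexHull_range_iff p).2 ⟨t, ht, rfl⟩
    obtain ⟨σ, hσ, hxσ⟩ := Geometry.SimplicialComplex.mem_space_iff.1 hx
    exact ⟨σ, hσ, exists_faceWeights hσ hxσ⟩
  obtain ⟨t, ht, htA⟩ := exists_mem_stdSimplex_of_cover A hAclosed fun t ht ↦ by
    obtain ⟨σ, hσ, w, hw, hwt⟩ := hlift t ht
    obtain ⟨j, -, hj⟩ := Finset.exists_le_of_sum_le (s := Finset.univ) Finset.univ_nonempty
      (hGsum w hw.1).le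
    exact ⟨j, hmemA.2 ⟨σ, hσ, w, hw, hj, hwt⟩⟩
  obtain ⟨σ, hσ, w, hw, hwt⟩ := hlift t ht
  have hvert : ∀ v : T.vertices, ∃ s ∈ stdSimplex ℝ (Fin n), φ s = v := fun v ↦
    (mem_convexHull_range_iff p).1 (hT.space_eq ▸ T.vertices_subset_space v.2)
  choose s hs hsv using hvert
  have hzero : ∀ j, t j = 0 → ∀ v, w v ≠ 0 → ∀ i, lab i v ≠ j := by
    intro j hj v hv i
    -- Averaging the coordinates of the vertices gives those of the point, so where `t j = 0` every
    -- vertex of nonzero weight has `j`-th coordinate zero.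
    have hts : (fun k ↦ ∑ v, w v * s v k) = t := by
      refine eq_of_sum_smul_eq hp ?_ ?_
      · rw [Finset.sum_comm, ht.2, ← hw.1.2]
        exact Finset.sum_congr rfl fun v _ ↦ by rw [← Finset.mul_sum, (hs v).2, mul_one]
      · change _ = φ t
        rw [← hwt]
        simp_rw [Finset.sum_smul]
        rw [Finset.sum_comm]
        refine Finset.sum_congr rfl fun v _ ↦ ?_
        conv_rhs => rw [← hsv v]
        simp only [φ, Finset.smul_sum, mul_smul]
    have hsvj : s v j = 0 := by
      have h0 := (congrFun hts j).trans hj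
      have := (Finset.sum_eq_zero_iff_of_nonneg fun v _ ↦
        mul_nonneg (hw.1.1 v) ((hs v).1 j)).1 h0 v (Finset.mem_univ v)
      exact (mul_eq_zero.1 this).resolve_left hv
    -- Such a vertex lies in the facet opposite `p j`, where label `j` is forbidden.
    refine hlab i v {k | k ≠ j} ?_
    rw [← hsv v]
    have : φ (s v) = ∑ k ∈ Finset.univ.erase j, s v k • p k :=
      (Finset.sum_erase _ (by rw [hsvj, zero_smul])).symm
    rw [this]
    refine (convex_convexHull ℝ _).sum_mem (fun k _ ↦ (hs v).1 k) ?_ fun k hk ↦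
      subset_convexHull ℝ _ ⟨k, Finset.ne_of_mem_erase hk, rfl⟩
    rw [Finset.sum_erase _ hsvj, (hs v).2]
  have hGle : ∀ j, G w j ≤ y j := by
    intro j
    by_cases hj : t j = 0
    · have : G w j = 0 := Finset.sum_eq_zero fun i _ ↦ mul_eq_zero_of_right _ <|
        Finset.sum_eq_zero fun v _ ↦ by
          split_ifs with h
          · by_contra hv
            exact hzero j hj v hv i h
          · rfl
      exact this.trans_le (hy j).le
    · obtain ⟨σ', hσ', w', hw', hle, hwt'⟩ := hmemA.1 (htA j hj)
      -- The witness in `A j` may come from another simplex `σ'`; uniqueness of weights transfers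
      -- its inequality to `w`.
      rwa [faceWeights_eq hσ hσ' hw hw' (hwt.trans hwt'.symm)]
  refine ⟨σ, hσ, a w, fun i j ↦ ?_, hasum w hw.1, fun j ↦ ?_, fun i j hij ↦ ?_⟩
  · refine Finset.sum_nonneg fun v _ ↦ ?_
    split_ifs
    · exact hw.1.1 v
    · exact le_rfl
  · exact (Finset.sum_eq_sum_iff_of_le fun j _ ↦ hGle j).1 (hGsum w hw.1) j (Finset.mem_univ j)
  · obtain ⟨v, -, hv⟩ := Finset.exists_ne_zero_of_sum_ne_zero hij
    obtain ⟨hvj, hv⟩ := ite_ne_right_iff.1 hv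
    exact ⟨v, by_contra fun h ↦ hv (hw.2 v h), hvj⟩

theorem le_ncard_of_lt_sum {ι : Type*} [Fintype ι] {b : ι → ℝ} (hb : ∀ i, b i ≤ 1) {k : ℕ}
    (hk : (k : ℝ) - 1 < ∑ i, b i) {S : Set ι} (hS : ∀ i, b i ≠ 0 → i ∈ S) : k ≤ S.ncard := by
  classical
  have h1 : ∑ i, b i ≤ ∑ i, if i ∈ S then (1 : ℝ) else 0 := Finset.sum_le_sum fun i _ ↦ by
    split_ifs with h
    · exact hb i
    · exact (not_not.1 (mt (hS i) h)).le
  have h2 : ∑ i, (if i ∈ S then (1 : ℝ) else 0) = S.ncard := by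
    rw [Finset.sum_boole, Set.ncard_eq_toFinset_card']
    congr 2
    ext
    simp
  have : (k : ℝ) < (S.ncard : ℝ) + 1 := by linarith
  exact Nat.lt_succ_iff.1 (by exact_mod_cast this)

end Average

end MultiSperner

theorem mainTheorem8 {E : Type*} [NormedAddCommGroup E] [InnerProductSpace ℝ E]
    [FiniteDimensional ℝ E] {n m : ℕ} (hn : 1 ≤ n)
    (p : Fin n → E) (hp : AffineIndependent ℝ p)
    (T : Geometry.SimplicialComplex ℝ E)
    (hT : MultiSperner.IsTriangulation T (convexHull ℝ (Set.range p)))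
    (lab : Fin m → T.vertices → Fin n)
    (hlab : ∀ i, MultiSperner.IsSpernerLabeling p T (lab i)) :
    (∀ k : Fin m → ℕ, (∀ i, 0 < k i) → ∑ i, k i = m + n - 1 →
      ∃ σ ∈ T.faces, ∀ i, k i ≤ (MultiSperner.labelsOn (lab i) σ).ncard) ∧
    (∀ l : Fin n → ℕ, (∀ j, 0 < l j) → ∑ j, l j = m + n - 1 →
      ∃ τ ∈ T.faces, ∀ j, l j ≤ {i : Fin m | j ∈ MultiSperner.labelsOn (lab i) τ}.ncard) := by
  have hn0 : (0 : ℝ) < n := by exact_mod_cast hn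
  refine ⟨fun k hk hsum ↦ ?_, fun l hl hsum ↦ ?_⟩
  -- For `m = 0` any simplex will do, and `1 / m` below would be a junk value.
  · rcases Nat.eq_zero_or_pos m with rfl | hm
    · have hx : p ⟨0, hn⟩ ∈ T.space := by
        rw [hT.space_eq]
        exact subset_convexHull ℝ _ ⟨_, rfl⟩
      obtain ⟨σ, hσ, -⟩ := Geometry.SimplicialComplex.mem_space_iff.1 hx
      exact ⟨σ, hσ, fun i ↦ i.elim0⟩
    have hm0 : (0 : ℝ) < m := by exact_mod_cast hm
    have hk1 : ∀ i, (1 : ℝ) ≤ k i := fun i ↦ by exact_mod_cast hk i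
    have hr : ∀ i, 0 < (k i : ℝ) - 1 + 1 / m := fun i ↦
      add_pos_of_nonneg_of_pos (sub_nonneg.2 (hk1 i)) (by positivity)
    have hsum' : ∑ i, (k i : ℝ) = m + n - 1 := by
      rw [← Nat.cast_sum, hsum, Nat.cast_sub (by omega)]
      push_cast
      ring
    -- The excess `1 / m` makes the weights total `n`, the sum of the targets 1, while keeping row
    -- `i` strictly above `k i - 1`.
    obtain ⟨σ, hσ, a, ha0, ha1, hcol, hlabel⟩ := MultiSperner.exists_face_average hn hp hT hlab
      (fun i ↦ (k i : ℝ) - 1 + 1 / m) (y := fun _ ↦ 1) (fun _ ↦ one_pos) (by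
        rw [Finset.sum_add_distrib, Finset.sum_sub_distrib, hsum']
        simp [hm0.ne']
        ring)
    refine ⟨σ, hσ, fun i ↦ MultiSperner.le_ncard_of_lt_sum
      (b := fun j ↦ ((k i : ℝ) - 1 + 1 / m) * a i j) (fun j ↦ ?_) ?_
      fun j hj ↦ hlabel i j (right_ne_zero_of_mul hj)⟩
    · refine le_of_le_of_eq ?_ (hcol j)
      exact Finset.single_le_sum (f := fun i ↦ ((k i : ℝ) - 1 + 1 / m) * a i j)
        (fun i _ ↦ mul_nonneg (hr i).le (ha0 i j)) (Finset.mem_univ i)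
    · rw [← Finset.mul_sum, ha1, mul_one]
      exact lt_add_of_pos_right _ (by positivity)
  · have hl1 : ∀ j, (1 : ℝ) ≤ l j := fun j ↦ by exact_mod_cast hl j
    have hsum' : ∑ j, (l j : ℝ) = m + n - 1 := by
      rw [← Nat.cast_sum, hsum, Nat.cast_sub (by omega)]
      push_cast
      ring
    -- Here the targets total `m`, the sum of the unit weights; entries are at most 1 because each
    -- row sums to 1.
    obtain ⟨τ, hτ, a, ha0, ha1, hcol, hlabel⟩ := MultiSperner.exists_face_average hn hp hT hlab
      (fun _ ↦ 1) (y := fun j ↦ (l j : ℝ) - 1 + 1 / n)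
      (fun j ↦ add_pos_of_nonneg_of_pos (sub_nonneg.2 (hl1 j)) (by positivity)) (by
        rw [Finset.sum_add_distrib, Finset.sum_sub_distrib, hsum']
        simp [hn0.ne']
        ring)
    refine ⟨τ, hτ, fun j ↦ MultiSperner.le_ncard_of_lt_sum (b := fun i ↦ a i j) (fun i ↦ ?_) ?_
      fun i hi ↦ hlabel i j hi⟩
    · rw [← ha1 i]
      exact Finset.single_le_sum (fun j _ ↦ ha0 i j) (Finset.mem_univ j)
    · have := hcol j
      simp only [one_mul] at this
      rw [this]
      exact lt_add_of_pos_right _ (by positivity)
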